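/- Let $\mathbb D^2$ be the closed $2$-disc, let $I=[0,1]$ and let $n\in\mathbb N$. An $n$-valued map $\phi\colon X\multimap Y$ between topological spaces assigns to each $x\in X$ a closed subset $\phi(x)\subset Y$ with exactly $n$ elements, such that for every open $V\subset Y$ the sets $\{x:\phi(x)\subset V\}$ and $\{x:\phi(x)\cap V\neq\varnothing\}$ are open in $X$. Two $n$-valued maps $\phi,\psi\colon X\multimap Y$ are homotopic if there is an $n$-valued map $H\colon X\times I\multimap Y$ with $H(\cdot,0)=\phi$ and $H(\cdot,1)=\psi$. For $\phi\colon X\multimap X$, put $\mathrm{Fix}(\phi)=\{x: x\in\phi(x)\}$. Two points $x,x'\in\mathrm{Fix}(\phi)$ are Nielsen equivalent if there are a path $\lambda\colon I\to X$ from $x$ to $x'$, continuous maps $g_1,\dots,g_n\colon I\to X$ with $\phi(\lambda(t))=\{g_1(t),\dots,g_n(t)\}$ for all $t$, and an index $j$ such that $g_j$ is a path from $x$ to $x'$ homotopic to $\lambda$ relative to the endpoints; the equivalence classes are the Nielsen fixed point classes of $\phi$. The index of such a class $C$ is the usual fixed point index at $C$ of the continuous single-valued branch of $\phi$, defined near $C$,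 that fixes the points of $C$. The Nielsen number $N(\phi)$ is the number of Nielsen fixed point classes of non-zero index. Then $\mathbb D^2$ has the Wecken property for $n$-valued maps: every $n$-valued map $\phi\colon\mathbb D^2\multimap\mathbb D^2$ is homotopic to an $n$-valued map with exactly $N(\phi)$ fixed points. Moreover, for every subset $A\subset\mathbb D^2$ with exactly $n$ elements, every $n$-valued map $\mathbb D^2\multimap\mathbb D^2$ is homotopic to the constant $n$-valued map $c_A$ with value $A$, and $c_A$ has exactly $n$ fixed points and Nielsen number $N(c_A)=n$. -/

import Mathlib

open scoped unitInterval

/-- A (continuous) `n`-valued map `X ⊸ Y`: to each point of `X` it associates a closed subset of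
`Y` with exactly `n` elements, and it is both upper and lower semi-continuous. -/
structure NValuedMap (n : ℕ) (X Y : Type*) [TopologicalSpace X] [TopologicalSpace Y] where
  /-- the underlying set-valued function -/
  toFun : X → Set Y
  encard_eq : ∀ x, (toFun x).encard = n
  isClosed : ∀ x, IsClosed (toFun x)
  isOpen_subset : ∀ V : Set Y, IsOpen V → IsOpen {x | toFun x ⊆ V}
  isOpen_inter : ∀ V : Set Y, IsOpen V → IsOpen {x | (toFun x ∩ V).Nonempty}

namespace NValuedMap

section General

variable {n : ℕ} {X Y : Type*} [TopologicalSpace X] [TopologicalSpace Y]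

/-- The constant `n`-valued map with value the `n`-point set `A`. -/
def const (X : Type*) [TopologicalSpace X] [T1Space Y] (A : Set Y) (hA : A.encard = n) :
    NValuedMap n X Y where
  toFun _ := A
  encard_eq _ := hA
  isClosed _ := (Set.finite_of_encard_eq_coe hA).isClosed
  isOpen_subset _ _ := isOpen_const
  isOpen_inter _ _ := isOpen_const

/-- Homotopy of `n`-valued maps, through an `n`-valued map `X × I ⊸ Y`. -/
def Homotopic (φ ψ : NValuedMap n X Y) : Prop :=
  ∃ H : NValuedMap n (X × I) Y, ∀ x, H.toFun (x, 0) = φ.toFun x ∧ H.toFun (x, 1) = ψ.toFun x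

/-- The fixed points of an `n`-valued self-map: the points `x` with `x ∈ φ x`. -/
def fixedPoints (φ : NValuedMap n X X) : Set X := {x | x ∈ φ.toFun x}

/-- The Nielsen relation: there are a path `p` from `x` to `y` and a splitting
`φ ∘ p = {g₁, …, gₙ}` into single-valued maps, one of which is a path `q` from `x` to `y` that is
homotopic to `p` relative to the endpoints. -/
def NielsenRel (φ : NValuedMap n X X) (x y : X) : Prop :=
  ∃ (p q : Path x y) (g : Fin n → C(I, X)) (j : Fin n),
    (∀ t, φ.toFun (p t) = Set.range fun i => g i t) ∧
      g j = q.toContinuousMap ∧ p.Homotopic q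

/-- The Nielsen fixed point classes: the classes of the Nielsen relation on the fixed points. -/
def IsNielsenClass (φ : NValuedMap n X X) (C : Set X) : Prop :=
  ∃ x ∈ φ.fixedPoints, C = {y | y ∈ φ.fixedPoints ∧ φ.NielsenRel x y}

end General

end NValuedMap

/-- The `2`-disc, as the closed unit disc of the complex plane. -/
abbrev Disc : Type := Metric.closedBall (0 : ℂ) 1

/-- The radial retraction of the plane onto the disc: `z ↦ z` if `‖z‖ ≤ 1`, and `z ↦ z / ‖z‖`
otherwise. -/
noncomputable def Disc.retraction (z : ℂ) : Disc :=
  ⟨((max 1 ‖z‖ : ℝ) : ℂ)⁻¹ * z, by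
    have h : (0 : ℝ) < max 1 ‖z‖ := lt_max_of_lt_left one_pos
    rw [mem_closedBall_zero_iff, norm_mul, norm_inv, Complex.norm_real, Real.norm_of_nonneg h.le,
      inv_mul_le_one₀ h]
    exact le_max_right _ _⟩

/-- The closed curve `γ`, parametrised by `[0, 2π]`, avoids `0` and has winding number `k` about
`0`: a continuous logarithm of `γ` along `[0, 2π]` increases by `2πik`. -/
def HasWindingNumber (γ : ℝ → ℂ) (k : ℤ) : Prop :=
  ∃ θ : ℝ → ℂ, ContinuousOn θ (Set.Icc 0 (2 * Real.pi)) ∧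
    (∀ t ∈ Set.Icc 0 (2 * Real.pi), Complex.exp (θ t) = γ t) ∧
    θ (2 * Real.pi) = θ 0 + k * (2 * Real.pi * Complex.I)

/-- The index of the isolated fixed point `a` of the planar map `g` is `k`: the vector field
`z - g z` has winding number `k` along all sufficiently small circles centred at `a`. -/
def HasLocalIndex (g : ℂ → ℂ) (a : ℂ) (k : ℤ) : Prop :=
  ∃ ε > 0, ∀ r ∈ Set.Ioo (0 : ℝ) ε,
    HasWindingNumber (fun t => circleMap a r t - g (circleMap a r t)) k

/-- The fixed point index over the open set `U ⊆ ℂ` of a continuous map `f : U → ℂ` (with compact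
fixed point set) is `k`: one may change `f` on a compact subset of `U` to a continuous map
`g : U → ℂ` with finitely many fixed points, the indices of which add up to `k`. (The integer `k`
does not depend on the choice of `g`.) -/
def HasIndexOn (f : ℂ → ℂ) (U : Set ℂ) (k : ℤ) : Prop :=
  ∃ (g : ℂ → ℂ) (L : Set ℂ) (F : Finset ℂ) (m : ℂ → ℤ),
    ContinuousOn g U ∧ IsCompact L ∧ L ⊆ U ∧ (∀ z ∈ U \ L, g z = f z) ∧
      (F : Set ℂ) = {z | z ∈ U ∧ g z = z} ∧ (∀ z ∈ F, HasLocalIndex g z (m z)) ∧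
      k = ∑ z ∈ F, m z

namespace NValuedMap

variable {n : ℕ}

/-- The index of a set `C` of fixed points (a fixed point class, for instance) of the `n`-valued map
`φ` of the disc is `k`. Near `C`, the map `φ` has a unique continuous single-valued branch `f` that
fixes the points of `C`, and the index of `C` is the fixed point index of `f`. As usual, the index
of a map of the disc is that of its composite with a retraction of the plane onto the disc, so `f`
is a branch of `φ ∘ r` over an open set `U` of the plane, with fixed point set `C`. -/
def HasFixedPointIndex (φ : NValuedMap n Disc Disc) (C : Set Disc) (k : ℤ) : Prop :=
  ∃ (U : Set ℂ) (f : ℂ → ℂ), IsOpen U ∧ ContinuousOn f U ∧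
    (∀ z ∈ U, ∃ w ∈ φ.toFun (Disc.retraction z), f z = w) ∧
    {z | z ∈ U ∧ f z = z} = Subtype.val '' C ∧ HasIndexOn f U k

/-- A set of fixed points is essential if its index is non-zero. -/
def IsEssential (φ : NValuedMap n Disc Disc) (C : Set Disc) : Prop :=
  ∃ k : ℤ, k ≠ 0 ∧ φ.HasFixedPointIndex C k

/-- The Nielsen number: the number of essential Nielsen fixed point classes. -/
noncomputable def nielsenNumber (φ : NValuedMap n Disc Disc) : ℕ∞ :=
  {C : Set Disc | φ.IsNielsenClass C ∧ φ.IsEssential C}.encard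

end NValuedMap

/-- The Wecken property of the disc for `n`-valued maps: every `n`-valued map `φ` of the disc is
homotopic to an `n`-valued map with exactly `N(φ)` fixed points. -/
def DiscHasWeckenProperty (n : ℕ) : Prop :=
  ∀ φ : NValuedMap n Disc Disc,
    ∃ ψ : NValuedMap n Disc Disc, φ.Homotopic ψ ∧ ψ.fixedPoints.encard = φ.nielsenNumber

/-! Since the disc is simply connected, the covering given by the graph of an `n`-valued map `φ` is
trivial, so `φ` splits into maps `f₁, …, fₙ` that nowhere coincide (`exists_splitting`). All paths
with the same endpoints are homotopic, so the Nielsen classes are the non-empty sets `Fix fᵢ`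
(`isNielsenClass_iff`). By Brouwer each is non-empty, they are pairwise distinct, and each has index
`1`; hence `N(φ) = n`.

A splitting is a map from the disc to the configuration space. It is null-homotopic because the disc
is contractible, and configurations in the disc are joined by paths (`joined_configuration`), so `φ`
is homotopic to every constant map `c_A`. The fixed points of `c_A` are the `n` points of `A`, which
gives the Wecken property. -/

/-- The ordered configuration space of `n` distinct points of `Y`. -/
abbrev Configuration (n : ℕ) (Y : Type*) : Type _ := {f : Fin n → Y // Function.Injective f}

namespace Configuration

variable {n : ℕ} {Y : Type*}

theorem encard_range (c : Configuration n Y) : (Set.range c.1).encard = n := by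
  rw [← Set.image_univ, c.2.encard_image, Set.encard_univ, ENat.card_eq_coe_fintype_card,
    Fintype.card_fin]

theorem exists_range_eq {A : Set Y} (hA : A.encard = n) :
    ∃ c : Configuration n Y, Set.range c.1 = A := by
  have hfin := Set.finite_of_encard_eq_coe hA
  have := hfin.fintype
  have hcard : Fintype.card A = n := by
    have h := hA
    rw [Set.encard_eq_coe_toFinset_card, Set.toFinset_card] at h
    exact_mod_cast h
  let e := (Fintype.equivFinOfCardEq hcard).symm
  refine ⟨⟨fun i => (e i : Y), Subtype.val_injective.comp e.injective⟩, ?_⟩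
  change Set.range (Subtype.val ∘ e) = A
  rw [e.surjective.range_comp, Subtype.range_coe]

theorem continuous_apply {X : Type*} [TopologicalSpace X] [TopologicalSpace Y]
    (F : C(X, Configuration n Y)) (i : Fin n) : Continuous fun x => (F x).1 i :=
  (_root_.continuous_apply i).comp (continuous_subtype_val.comp F.continuous)

end Configuration

/-! ### Splitting over simply connected spaces. -/

namespace NValuedMap

section Splitting

variable {n : ℕ} {X Y : Type*} [TopologicalSpace X] [TopologicalSpace Y]

/-- The `n`-valued map whose values are the points of a continuous family of configurations. -/
def ofConfiguration [T1Space Y] (F : C(X, Configuration n Y)) : NValuedMap n X Y where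
  toFun x := Set.range (F x).1
  encard_eq x := Configuration.encard_range (F x)
  isClosed x := (Set.finite_range _).isClosed
  isOpen_subset V hV := by
    have h : {x | Set.range (F x).1 ⊆ V} = ⋂ i, (fun x => (F x).1 i) ⁻¹' V := by
      ext x
      simp [Set.range_subset_iff]
    rw [h]
    exact isOpen_iInter_of_finite fun i => hV.preimage (Configuration.continuous_apply F i)
  isOpen_inter V hV := by
    have h : {x | (Set.range (F x).1 ∩ V).Nonempty} = ⋃ i, (fun x => (F x).1 i) ⁻¹' V := by
      ext x
      simp [Set.Nonempty]
    rw [h]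
    exact isOpen_iUnion fun i => hV.preimage (Configuration.continuous_apply F i)

/-- Homotopic families of configurations give homotopic `n`-valued maps. -/
theorem homotopic_of_configuration [T1Space Y] {φ ψ : NValuedMap n X Y}
    {F G : C(X, Configuration n Y)} (hF : ∀ x, φ.toFun x = Set.range (F x).1)
    (hG : ∀ x, ψ.toFun x = Set.range (G x).1) (h : F.Homotopic G) : φ.Homotopic ψ := by
  obtain ⟨H⟩ := h
  refine ⟨ofConfiguration (H.toContinuousMap.comp ⟨Prod.swap, continuous_swap⟩), fun x => ?_⟩
  rw [hF, hG]
  constructor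
  · change Set.range (H (0, x)).1 = _
    rw [H.apply_zero]
  · change Set.range (H (1, x)).1 = _
    rw [H.apply_one]

/-- Locally, an `n`-valued map into a Hausdorff space splits into `n` continuous branches with
values in disjoint open sets. -/
theorem exists_local_branches [T2Space Y] (φ : NValuedMap n X Y) (x₀ : X) :
    ∃ (U : Set X) (V : Fin n → Set Y) (s : Fin n → X → Y), IsOpen U ∧ x₀ ∈ U ∧
      (∀ i, IsOpen (V i)) ∧ Pairwise (Function.onFun Disjoint V) ∧
      (∀ i, ContinuousOn (s i) U) ∧ (∀ x ∈ U, ∀ i, s i x ∈ V i) ∧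
      ∀ x ∈ U, φ.toFun x = Set.range fun i => s i x := by
  classical
  obtain ⟨c, hc⟩ := Configuration.exists_range_eq (φ.encard_eq x₀)
  obtain ⟨V, hV, hdisj⟩ := Pairwise.exists_mem_filter_basis_of_disjoint
    (l := fun i => nhds (c.1 i)) (fun i j hij => disjoint_nhds_nhds.2 (c.2.ne hij))
    (fun i => nhds_basis_opens (c.1 i))
  have hmem : ∀ i, c.1 i ∈ φ.toFun x₀ := fun i => hc ▸ Set.mem_range_self i
  -- Over `U` the `n` values meet all `n` disjoint sets `V i`, so each `V i` contains exactly one of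
  -- them.
  let U : Set X := ⋂ i, {x | (φ.toFun x ∩ V i).Nonempty}
  have hUo : IsOpen U := isOpen_iInter_of_finite fun i => φ.isOpen_inter _ (hV i).2
  have hU : ∀ i x, ∃ y, x ∈ U → y ∈ φ.toFun x ∩ V i := by
    intro i x
    by_cases hx : x ∈ U
    · obtain ⟨y, hy⟩ := Set.mem_iInter.1 hx i
      exact ⟨y, fun _ => hy⟩
    · exact ⟨c.1 i, fun h => absurd h hx⟩
  choose s hs using hU
  have hrange : ∀ x ∈ U, φ.toFun x = Set.range fun i => s i x := by
    intro x hx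
    have hinj : Function.Injective fun i => s i x := by
      intro i j hij
      by_contra hne
      exact Set.disjoint_left.1 (hdisj hne) (hs i x hx).2 (by
        change s i x = s j x at hij
        rw [hij]
        exact (hs j x hx).2)
    refine ((Set.finite_range _).eq_of_subset_of_encard_le
      (Set.range_subset_iff.2 fun i => (hs i x hx).1) ?_).symm
    rw [φ.encard_eq x, Configuration.encard_range ⟨fun i => s i x, hinj⟩]
  have huniq : ∀ x ∈ U, ∀ i, ∀ y ∈ φ.toFun x, y ∈ V i → y = s i x := by
    intro x hx i y hy hyV
    rw [hrange x hx] at hy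
    obtain ⟨j, rfl⟩ := hy
    by_contra hne
    have hij : i ≠ j := by
      rintro rfl
      exact hne rfl
    exact Set.disjoint_left.1 (hdisj hij) hyV (hs j x hx).2
  refine ⟨U, V, s, hUo, Set.mem_iInter.2 fun i => ⟨c.1 i, hmem i, (hV i).1⟩, fun i => (hV i).2,
    hdisj, fun i => ?_, fun x hx i => (hs i x hx).2, hrange⟩
  intro x hx
  rw [ContinuousWithinAt, tendsto_nhds]
  intro O hO hxO
  -- Lower semicontinuity is applied to `V i ∩ O`: near `x` some value lies there, and by uniqueness
  -- in `V i` it is the `i`-th branch.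
  have hmemO : {x | (φ.toFun x ∩ (V i ∩ O)).Nonempty} ∈ nhds x :=
    (φ.isOpen_inter _ ((hV i).2.inter hO)).mem_nhds ⟨s i x, (hs i x hx).1, (hs i x hx).2, hxO⟩
  filter_upwards [mem_nhdsWithin_of_mem_nhds hmemO, self_mem_nhdsWithin] with x' hx' hx'U
  obtain ⟨y, hy, hyV, hyO⟩ := hx'
  rw [huniq x' hx'U i y hy hyV] at hyO
  exact hyO

/-- The graph of an `n`-valued map. -/
abbrev Graph (φ : NValuedMap n X Y) : Type _ := {p : X × Y // p.2 ∈ φ.toFun p.1}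

/-- The graph of an `n`-valued map into a Hausdorff space is a covering space of the domain. -/
theorem isCoveringMap_graph [T2Space Y] (φ : NValuedMap n X Y) :
    IsCoveringMap fun p : φ.Graph => p.1.1 := by
  intro x₀
  obtain ⟨U, V, s, hUo, hx₀, hVo, hdisj, hsc, hsV, hrange⟩ := φ.exists_local_branches x₀
  suffices h : IsEvenlyCovered (fun p : φ.Graph => p.1.1) x₀ (Fin n) from
    h.to_isEvenlyCovered_preimage
  refine ⟨inferInstance, U, hx₀, hUo, hUo.preimage (by fun_prop), ?_⟩
  have hbranch : ∀ e : (fun p : φ.Graph => p.1.1) ⁻¹' U, ∃ i, s i e.1.1.1 = e.1.1.2 := fun e => by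
    have h := e.1.2
    rw [hrange _ e.2] at h
    exact h
  choose b hb using hbranch
  have hbV : ∀ e i, e.1.1.2 ∈ V i → b e = i := by
    intro e i hi
    by_contra hne
    exact Set.disjoint_left.1 (hdisj hne) (hb e ▸ hsV _ e.2 (b e)) hi
  have hbc : Continuous b := by
    refine continuous_discrete_rng.2 fun i => ?_
    have h : b ⁻¹' {i} = (fun e => e.1.1.2) ⁻¹' V i := by
      ext e
      refine ⟨?_, hbV e i⟩
      rintro rfl
      have h := hsV _ e.2 (b e)
      rwa [hb e] at h
    rw [h]
    exact (hVo i).preimage (by fun_prop)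
  refine ⟨{ toFun := fun e => (⟨e.1.1.1, e.2⟩, b e)
            invFun := fun p => ⟨⟨(p.1.1, s p.2 p.1.1), by
              rw [hrange _ p.1.2]
              exact Set.mem_range_self p.2⟩, p.1.2⟩
            left_inv := fun e => by
              apply Subtype.ext
              apply Subtype.ext
              exact Prod.ext rfl (hb e)
            right_inv := fun p => Prod.ext rfl (hbV _ _ (hsV _ p.1.2 _))
            continuous_toFun := by fun_prop
            continuous_invFun := ?_ }, fun _ => rfl⟩
  refine Continuous.subtype_mk (Continuous.subtype_mk (Continuous.prodMk (by fun_prop) ?_) _) _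
  refine continuous_iff_continuousAt.2 fun p => ?_
  have h1 : Continuous fun x : U => s p.2 x := (hsc p.2).domRestrict
  have h2 : (fun q : U × Fin n => s q.2 q.1) =ᶠ[nhds p] fun q => s p.2 q.1 := by
    have : {q : U × Fin n | q.2 = p.2} ∈ nhds p :=
      ((isOpen_discrete {p.2}).preimage continuous_snd).mem_nhds rfl
    filter_upwards [this] with q hq
    rw [show q.2 = p.2 from hq]
  exact (h1.comp continuous_fst).continuousAt.congr h2.symm

/-- An `n`-valued map from a simply connected space to a Hausdorff space splits into `n`
single-valued maps without coincidences. -/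
theorem exists_splitting [SimplyConnectedSpace X] [LocallyPathConnectedSpace X] [T2Space Y]
    (φ : NValuedMap n X Y) :
    ∃ F : C(X, Configuration n Y), ∀ x, φ.toFun x = Set.range (F x).1 := by
  have x₀ : X := Classical.arbitrary X
  obtain ⟨c, hc⟩ := Configuration.exists_range_eq (φ.encard_eq x₀)
  have hcov := φ.isCoveringMap_graph
  have hlift : ∀ i, ∃ S : C(X, φ.Graph), (S x₀).1.2 = c.1 i ∧ ∀ x, (S x).1.1 = x := by
    intro i
    obtain ⟨S, ⟨hS, hS'⟩, -⟩ := hcov.existsUnique_continuousMap_lifts (ContinuousMap.id X) x₀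
      ⟨(x₀, c.1 i), hc ▸ Set.mem_range_self i⟩ rfl
    exact ⟨S, by rw [hS], fun x => congr_fun hS' x⟩
  choose S hS₀ hS using hlift
  have hinj : ∀ x, Function.Injective fun i => (S i x).1.2 := by
    intro x i j hij
    -- Lifts that agree at one point agree everywhere, in particular at `x₀`, where the `c.1 i` are
    -- distinct.
    have h : (S i : X → φ.Graph) = S j := by
      refine hcov.eq_of_comp_eq (S i).continuous (S j).continuous ?_ x ?_
      · funext y
        exact (hS i y).trans (hS j y).symm
      · exact Subtype.ext (Prod.ext ((hS i x).trans (hS j x).symm) hij)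
    apply c.2
    rw [← hS₀, ← hS₀, h]
  refine ⟨⟨fun x => ⟨fun i => (S i x).1.2, hinj x⟩, by fun_prop⟩, fun x => ?_⟩
  refine ((Set.finite_range _).eq_of_subset_of_encard_le
    (Set.range_subset_iff.2 fun i => ?_) ?_).symm
  · have h := (S i x).2
    rw [hS i x] at h
    exact h
  · rw [φ.encard_eq x]
    exact (Configuration.encard_range ⟨_, hinj x⟩).ge

end Splitting

end NValuedMap

/-! ### Topology of the disc: Brouwer's theorem and configurations. -/

instance : ContractibleSpace Disc :=
  (convex_closedBall (0 : ℂ) 1).contractibleSpace ⟨0, by simp⟩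

instance : LocallyPathConnectedSpace Disc :=
  (convex_closedBall (0 : ℂ) 1).locallyPathConnectedSpace

namespace Disc

theorem norm_le_one (x : Disc) : ‖(x : ℂ)‖ ≤ 1 := mem_closedBall_zero_iff.1 x.2

theorem continuous_retraction : Continuous retraction := by
  refine Continuous.subtype_mk (Continuous.mul (Continuous.inv₀ (by fun_prop) fun z => ?_)
    continuous_id) _
  exact Complex.ofReal_ne_zero.2 (lt_max_of_lt_left one_pos).ne'

theorem retraction_coe (x : Disc) : retraction x = x := by
  apply Subtype.ext
  simp [retraction, max_eq_left (norm_le_one x)]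

/-- **Brouwer's fixed point theorem** for the disc. -/
theorem exists_fixedPoint (f : C(Disc, Disc)) : ∃ x, f x = x := by
  by_contra! hf
  -- Without fixed points, `h` has a continuous logarithm `θ` on the disc. On the boundary circle `h
  -- / γ = 1 - f / γ` has a principal logarithm, so the difference of the two would be a periodic
  -- logarithm of `γ`.
  let h : C(Disc, ℂ) := ⟨fun x => x - f x, by fun_prop⟩
  have hh : ∀ x, h x ≠ 0 := fun x hx => hf x (Subtype.ext (sub_eq_zero.1 hx).symm)
  obtain ⟨θ, ⟨-, hθ⟩, -⟩ := Complex.isCoveringMapOn_exp.existsUnique_continuousMap_lifts h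
    (a₀ := 0) (Complex.exp_log (hh 0)) hh
  have hθ' : ∀ x, Complex.exp (θ x) = h x := congr_fun hθ
  let γ : ℝ → Disc := fun t => ⟨Complex.exp (t * Complex.I), by
    rw [mem_closedBall_zero_iff, Complex.norm_exp_ofReal_mul_I]⟩
  have hγc : Continuous γ := by fun_prop
  have hγ : ∀ t, (γ t : ℂ) ≠ 0 := fun t => Complex.exp_ne_zero _
  have hslit : ∀ t, h (γ t) / γ t ∈ Complex.slitPlane := by
    intro t
    have hw : ‖(f (γ t) : ℂ) / γ t‖ ≤ 1 := by
      rw [norm_div, Complex.norm_exp_ofReal_mul_I, div_one]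
      exact norm_le_one _
    have heq : h (γ t) / γ t = 1 - f (γ t) / γ t := by
      change ((γ t : ℂ) - f (γ t)) / γ t = _
      rw [sub_div, div_self (hγ t)]
    have hne : h (γ t) / γ t ≠ 0 := div_ne_zero (hh _) (hγ t)
    rw [heq] at hne ⊢
    generalize (f (γ t) : ℂ) / γ t = w at hw hne
    rw [Complex.mem_slitPlane_iff]
    by_contra! hcon
    simp only [Complex.sub_re, Complex.one_re, Complex.sub_im, Complex.one_im] at hcon
    apply hne
    have := Complex.re_le_norm w
    apply Complex.ext <;> simp <;> linarith [hcon.1, hcon.2]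
  -- `ψ` takes values in `2πiℤ`, so it is constant; but over one turn its first two terms return
  -- while the last changes by `2πi`.
  let ψ : ℝ → ℂ := fun t => θ (γ t) - Complex.log (h (γ t) / γ t) - t * Complex.I
  have hψc : Continuous ψ := by
    have h1 : Continuous fun t => Complex.log (h (γ t) / γ t) :=
      Continuous.clog (Continuous.div (by fun_prop) (by fun_prop) hγ) hslit
    fun_prop
  have hψ : ∀ t, Complex.exp (ψ t) = 1 := by
    intro t
    rw [Complex.exp_sub, Complex.exp_sub, hθ', Complex.exp_log (div_ne_zero (hh _) (hγ t)),
      div_div_cancel₀ (hh _)]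
    exact div_self (hγ t)
  have hconst := Complex.isCoveringMap_exp.const_of_comp hψc
    (fun t t' => Subtype.ext ((hψ t).trans (hψ t').symm)) 0 (2 * Real.pi)
  have hγ₀ : γ (2 * Real.pi) = γ 0 := Subtype.ext (by simp [γ])
  simp only [ψ, hγ₀] at hconst
  have hI : (2 * Real.pi : ℂ) * Complex.I = 0 := by
    push_cast at hconst
    linear_combination hconst
  exact Complex.two_pi_I_ne_zero hI

/-- Any two configurations of `n` points of the disc can be joined by a path of configurations. -/
theorem joined_configuration {n : ℕ} (c d : Configuration n Disc) : Joined c d := by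
  -- The interpolation parameter is complex: two given points collide for at most one `s`, and a
  -- countable set does not disconnect the plane.
  let v : ℂ → Fin n → ℂ := fun s i => (1 - s) * c.1 i + s * d.1 i
  let B : Set ℂ := ⋃ p : {p : Fin n × Fin n // p.1 ≠ p.2}, {s | v s p.1.1 = v s p.1.2}
  have hB : B.Countable := by
    refine Set.countable_iUnion fun p => Set.Subsingleton.countable fun s hs t ht => ?_
    have hne : (c.1 p.1.1 : ℂ) - c.1 p.1.2 ≠ 0 :=
      sub_ne_zero.2 fun h => p.2 (c.2 (Subtype.ext h))
    simp only [v, Set.mem_ofPred_eq] at hs ht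
    have h1 : ((c.1 p.1.1 : ℂ) - c.1 p.1.2) * (s - t) = 0 := by
      linear_combination (-t) * hs + s * ht
    exact sub_eq_zero.1 ((mul_eq_zero.1 h1).resolve_left hne)
  have hv : ∀ s ∈ Bᶜ, Function.Injective (v s) := by
    intro s hs i j hij
    by_contra hne
    exact hs (Set.mem_iUnion.2 ⟨⟨(i, j), hne⟩, hij⟩)
  have h0 : (0 : ℂ) ∈ Bᶜ := by
    intro h
    obtain ⟨p, hp⟩ := Set.mem_iUnion.1 h
    exact p.2 (c.2 (Subtype.ext (by simpa [v] using hp)))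
  have h1 : (1 : ℂ) ∈ Bᶜ := by
    intro h
    obtain ⟨p, hp⟩ := Set.mem_iUnion.1 h
    exact p.2 (d.2 (Subtype.ext (by simpa [v] using hp)))
  have hrank : 1 < Module.rank ℝ ℂ := by
    rw [Complex.rank_real_complex]
    exact Cardinal.one_lt_two
  obtain ⟨γ, hγ⟩ := (hB.isPathConnected_compl_of_one_lt_rank hrank).joinedIn 0 h0 1 h1
  -- Scaling all points by the same factor brings them into the disc and keeps them distinct; at
  -- both ends the factor is `1`.
  let N : I → ℝ := fun t => max 1 ‖v (γ t)‖
  have hN : ∀ t, 0 < N t := fun t => lt_max_of_lt_left one_pos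
  have hvc : Continuous fun t => v (γ t) := by fun_prop
  have hle : ∀ a : Configuration n Disc, ‖fun i => (a.1 i : ℂ)‖ ≤ 1 := fun a =>
    (pi_norm_le_iff_of_nonneg zero_le_one).2 fun i => norm_le_one _
  let ρ : I → Configuration n Disc := fun t => ⟨fun i => ⟨((N t : ℝ) : ℂ)⁻¹ * v (γ t) i, by
    rw [mem_closedBall_zero_iff, norm_mul, norm_inv, Complex.norm_real,
      Real.norm_of_nonneg (hN t).le, inv_mul_le_one₀ (hN t)]
    exact (norm_le_pi_norm _ i).trans (le_max_right _ _)⟩, fun i j hij =>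
    hv _ (hγ t) (mul_left_cancel₀ (inv_ne_zero (Complex.ofReal_ne_zero.2 (hN t).ne'))
      (congr_arg Subtype.val hij))⟩
  have hρ : Continuous ρ := by
    refine Continuous.subtype_mk (continuous_pi fun i => Continuous.subtype_mk
      (Continuous.mul (Continuous.inv₀ (by fun_prop) fun t => ?_) (by fun_prop)) _) _
    exact Complex.ofReal_ne_zero.2 (hN t).ne'
  refine ⟨⟨⟨ρ, hρ⟩, ?_, ?_⟩⟩
  · have hv0 : v 0 = fun i => (c.1 i : ℂ) := by
      funext i
      simp [v]
    apply Subtype.ext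
    funext i
    apply Subtype.ext
    have hN0 : max 1 ‖v 0‖ = 1 := max_eq_left (hv0 ▸ hle c)
    change ((max 1 ‖v (γ 0)‖ : ℝ) : ℂ)⁻¹ * v (γ 0) i = c.1 i
    rw [γ.source, hN0, hv0, Complex.ofReal_one, inv_one, one_mul]
  · have hv1 : v 1 = fun i => (d.1 i : ℂ) := by
      funext i
      simp [v]
    apply Subtype.ext
    funext i
    apply Subtype.ext
    have hN1 : max 1 ‖v 1‖ = 1 := max_eq_left (hv1 ▸ hle d)
    change ((max 1 ‖v (γ 1)‖ : ℝ) : ℂ)⁻¹ * v (γ 1) i = d.1 i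
    rw [γ.target, hN1, hv1, Complex.ofReal_one, inv_one, one_mul]

end Disc

/-! ### Homotopy to constants, and Nielsen classes of split maps. -/

namespace NValuedMap

variable {n : ℕ}

/-- Every `n`-valued map of the disc is homotopic to every constant one. -/
theorem homotopic_const (φ : NValuedMap n Disc Disc) (A : Set Disc) (hA : A.encard = n) :
    φ.Homotopic (const Disc A hA) := by
  obtain ⟨F, hF⟩ := φ.exists_splitting
  obtain ⟨d, hd⟩ := Configuration.exists_range_eq hA
  obtain ⟨c, hc⟩ := (id_nullhomotopic Disc).comp_right F
  refine homotopic_of_configuration hF (G := ContinuousMap.const Disc d) (fun _ => hd.symm)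
    (hc.trans ?_)
  obtain ⟨p⟩ := Disc.joined_configuration c d
  exact ⟨⟨⟨fun q => p q.1, by fun_prop⟩, fun _ => p.source, fun _ => p.target⟩⟩

/-- The Nielsen relation of a split `n`-valued map of a simply connected space: two fixed points
are related if and only if they are fixed points of the same branch. -/
theorem nielsenRel_iff {X : Type*} [TopologicalSpace X] [T2Space X] [SimplyConnectedSpace X]
    {φ : NValuedMap n X X} {F : C(X, Configuration n X)}
    (hF : ∀ x, φ.toFun x = Set.range (F x).1) {x y : X} {i : Fin n} (hx : (F x).1 i = x) :
    φ.NielsenRel x y ↔ (F y).1 i = y := by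
  constructor
  · rintro ⟨p, q, g, j, hg, hgj, -⟩
    have hq : ∀ t, ∃ k, (F (p t)).1 k = q t := by
      intro t
      have h : q t ∈ φ.toFun (p t) := by
        rw [hg]
        exact ⟨j, congr($hgj t)⟩
      rw [hF] at h
      exact h
    have hclosed : ∀ k, IsClosed {t | (F (p t)).1 k = q t} := fun k =>
      isClosed_eq ((Configuration.continuous_apply F k).comp p.continuous) q.continuous
    -- The splitting `g` need not be the one given by `F`. Still, `q t` is always exactly one of the
    -- finitely many values `(F (p t)).1 k`, so the set where it is the `i`-th is clopen in `I`.
    have hcompl : {t | (F (p t)).1 i = q t}ᶜ = ⋃ k : {k // k ≠ i}, {t | (F (p t)).1 k = q t} := by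
      ext t
      simp only [Set.mem_compl_iff, Set.mem_ofPred_eq, Set.mem_iUnion]
      constructor
      · intro ht
        obtain ⟨k, hk⟩ := hq t
        exact ⟨⟨k, by rintro rfl; exact ht hk⟩, hk⟩
      · rintro ⟨k, hk⟩ ht
        exact k.2 ((F (p t)).2 (hk.trans ht.symm))
    have hopen : IsOpen {t | (F (p t)).1 i = q t} := by
      rw [← isClosed_compl_iff, hcompl]
      exact isClosed_iUnion_of_finite fun k => hclosed k
    have huniv := IsClopen.eq_univ ⟨hclosed i, hopen⟩ ⟨0, by simpa using hx⟩
    have h1 : (1 : I) ∈ {t | (F (p t)).1 i = q t} := huniv ▸ Set.mem_univ _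
    simpa using h1
  · intro hy
    let p : Path x y := PathConnectedSpace.somePath x y
    let b : Fin n → C(I, X) := fun k =>
    ⟨fun t => (F (p t)).1 k, (Configuration.continuous_apply F k).comp p.continuous⟩
    refine ⟨p, ⟨b i, ?_, ?_⟩, b, i, fun t => hF _, rfl, SimplyConnectedSpace.paths_homotopic _ _⟩
    · simpa [b] using hx
    · simpa [b] using hy

/-- The Nielsen classes of a split `n`-valued map of a simply connected space are the nonempty
fixed point sets of its branches. -/
theorem isNielsenClass_iff {X : Type*} [TopologicalSpace X] [T2Space X] [SimplyConnectedSpace X]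
    {φ : NValuedMap n X X} {F : C(X, Configuration n X)}
    (hF : ∀ x, φ.toFun x = Set.range (F x).1) {C : Set X} :
    φ.IsNielsenClass C ↔ C.Nonempty ∧ ∃ i, {x | (F x).1 i = x} = C := by
  have hfix : ∀ x i, (F x).1 i = x → x ∈ φ.fixedPoints := fun x i h => by
    change x ∈ φ.toFun x
    rw [hF]
    exact ⟨i, h⟩
  have hclass : ∀ x i, (F x).1 i = x →
      {y | y ∈ φ.fixedPoints ∧ φ.NielsenRel x y} = {y | (F y).1 i = y} := by
    intro x i hx
    ext y
    simp only [Set.mem_ofPred_eq, nielsenRel_iff hF hx]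
    exact and_iff_right_of_imp (hfix y i)
  constructor
  · rintro ⟨x, hx, rfl⟩
    have hx' : x ∈ φ.toFun x := hx
    rw [hF] at hx'
    obtain ⟨i, hi⟩ := hx'
    rw [hclass x i hi]
    exact ⟨⟨x, hi⟩, i, rfl⟩
  · rintro ⟨⟨x, hx⟩, i, rfl⟩
    exact ⟨x, hfix x i hx, (hclass x i hx).symm⟩

end NValuedMap

/-! ### Fixed point index and Nielsen number. -/

/-- A planar map that is constantly `0` near `0` has local index `1` at `0`. -/
theorem hasLocalIndex_zero_of_eq_zero {g : ℂ → ℂ} {ε : ℝ} (hε : 0 < ε)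
    (hg : ∀ z, ‖z‖ < ε → g z = 0) : HasLocalIndex g 0 1 := by
  refine ⟨ε, hε, fun r hr => ⟨fun t => Real.log r + t * Complex.I, by fun_prop, fun t _ => ?_, ?_⟩⟩
  · dsimp only
    rw [hg _ (by rw [norm_circleMap_zero, abs_of_pos hr.1]; exact hr.2), sub_zero, circleMap_zero,
      Complex.exp_add, ← Complex.ofReal_exp, Real.exp_log hr.1]
  · simp

/-- A continuous map of the plane into the unit disc has fixed point index `1`. -/
theorem hasIndexOn_univ_of_norm_le_one {f : ℂ → ℂ} (hf : Continuous f) (hf' : ∀ z, ‖f z‖ ≤ 1) :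
    HasIndexOn f Set.univ 1 := by
  -- With this cutoff, `χ f` equals `f` off a compact ball. Its fixed points lie in the unit disc,
  -- where `χ = 0`, so `0` is the only one.
  let χ : ℂ → ℝ := fun z => max 0 (min 1 (‖z‖ - 2))
  have hχ0 : ∀ z, ‖z‖ ≤ 2 → χ z = 0 := fun z hz =>
    max_eq_left ((min_le_right _ _).trans (by linarith))
  have hχ1 : ∀ z, 3 ≤ ‖z‖ → χ z = 1 := fun z hz => by
    simp only [χ]
    rw [min_eq_left (by linarith), max_eq_right zero_le_one]
  have hχ : ∀ z, ‖(χ z : ℂ)‖ ≤ 1 := fun z => by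
    rw [Complex.norm_real, Real.norm_of_nonneg (le_max_left _ _)]
    exact max_le zero_le_one (min_le_left _ _)
  refine ⟨fun z => χ z * f z, Metric.closedBall 0 3, {0}, fun _ => 1, ?_,
    isCompact_closedBall 0 3, Set.subset_univ _, fun z hz => ?_, ?_, fun z hz => ?_, by simp⟩
  · exact (by fun_prop : Continuous fun z => (χ z : ℂ) * f z).continuousOn
  · have hz3 : 3 < ‖z‖ := by simpa using hz.2
    simp [hχ1 z hz3.le]
  · ext z
    simp only [Finset.coe_singleton, Set.mem_singleton_iff, Set.mem_ofPred_eq, Set.mem_univ,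
      true_and]
    constructor
    · rintro rfl
      simp [hχ0 0]
    · intro hz
      have hz1 : ‖z‖ ≤ 1 := by
        rw [← hz, norm_mul]
        exact mul_le_one₀ (hχ z) (norm_nonneg _) (hf' z)
      rw [← hz, hχ0 z (by linarith)]
      simp
  · rw [Finset.mem_singleton] at hz
    subst hz
    exact hasLocalIndex_zero_of_eq_zero two_pos fun z hz => by simp [hχ0 z hz.le]

namespace NValuedMap

variable {n : ℕ}

/-- The fixed point set of a branch of a split `n`-valued map of the disc has index `1`. -/
theorem hasFixedPointIndex_branch {φ : NValuedMap n Disc Disc} {F : C(Disc, Configuration n Disc)}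
    (hF : ∀ x, φ.toFun x = Set.range (F x).1) (i : Fin n) :
    φ.HasFixedPointIndex {x | (F x).1 i = x} 1 := by
  have hc : Continuous fun z : ℂ => ((F (Disc.retraction z)).1 i : ℂ) :=
    continuous_subtype_val.comp ((Configuration.continuous_apply F i).comp
      Disc.continuous_retraction)
  refine ⟨Set.univ, fun z => (F (Disc.retraction z)).1 i, isOpen_univ, hc.continuousOn,
    fun z _ => ⟨_, ?_, rfl⟩, ?_, hasIndexOn_univ_of_norm_le_one hc fun z => Disc.norm_le_one _⟩
  · rw [hF]
    exact Set.mem_range_self i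
  · ext z
    simp only [Set.mem_univ, true_and, Set.mem_ofPred_eq, Set.mem_image]
    constructor
    · intro hz
      -- A fixed point `z` is a value of the branch, so it lies in the disc and is left in place by
      -- the retraction.
      have hr' : Disc.retraction z = (F (Disc.retraction z)).1 i := by
        conv_lhs => rw [← hz]
        exact Disc.retraction_coe _
      exact ⟨Disc.retraction z, hr'.symm, (congr_arg Subtype.val hr').trans hz⟩
    · rintro ⟨x, hx, rfl⟩
      rw [Disc.retraction_coe, hx]

/-- The Nielsen number of every `n`-valued map of the disc is `n`. -/
theorem nielsenNumber_eq (φ : NValuedMap n Disc Disc) : φ.nielsenNumber = n := by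
  obtain ⟨F, hF⟩ := φ.exists_splitting
  let C : Fin n → Set Disc := fun i => {x | (F x).1 i = x}
  have hne : ∀ i, (C i).Nonempty := fun i =>
    Disc.exists_fixedPoint ⟨fun x => (F x).1 i, Configuration.continuous_apply F i⟩
  have hinj : Function.Injective C := by
    intro i j hij
    obtain ⟨x, hx⟩ := hne i
    have hx' : x ∈ C j := hij ▸ hx
    exact (F x).2 (Eq.trans hx (Eq.symm hx'))
  have hclasses : {C | φ.IsNielsenClass C ∧ φ.IsEssential C} = Set.range C := by
    ext D
    simp only [Set.mem_ofPred_eq, isNielsenClass_iff hF, Set.mem_range]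
    constructor
    · exact fun h => h.1.2
    · rintro ⟨i, rfl⟩
      exact ⟨⟨hne i, i, rfl⟩, 1, one_ne_zero, hasFixedPointIndex_branch hF i⟩
  rw [nielsenNumber, hclasses]
  exact Configuration.encard_range ⟨C, hinj⟩

end NValuedMap

theorem mainTheorem8 (n : ℕ) :
    DiscHasWeckenProperty n ∧
      ∀ (A : Set Disc) (hA : A.encard = n),
        (∀ φ : NValuedMap n Disc Disc, φ.Homotopic (NValuedMap.const Disc A hA)) ∧
        (NValuedMap.const Disc A hA).fixedPoints.encard = n ∧
        (NValuedMap.const Disc A hA).nielsenNumber = n := by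
  refine ⟨fun φ => ?_, fun A hA => ⟨fun φ => φ.homotopic_const A hA, hA,
    NValuedMap.nielsenNumber_eq _⟩⟩
  -- Any `n`-point set would do; a value of `φ` shows that one exists.
  refine ⟨NValuedMap.const Disc (φ.toFun 0) (φ.encard_eq 0), φ.homotopic_const _ _, ?_⟩
  rw [φ.nielsenNumber_eq]
  exact φ.encard_eq 0
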